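/- Let $\{c_n\}_{n\ge 1}$ be a real sequence and let $\{d_{n+1}\}_{n\ge 1}$ be a positive chain sequence, i.e. there is a sequence $\{g_n\}_{n\ge1}$ with $0\le g_1<1$, $0<g_n<1$ for $n\ge 2$, and $d_{n+1}=(1-g_n)g_{n+1}$ for $n\ge 1$. Let $\{\ell_n\}_{n\ge 1}$ be its minimal parameter sequence, i.e. $\ell_1=0$ and $(1-\ell_n)\ell_{n+1}=d_{n+1}$ for $n\ge1$. Define polynomials by $P_0=1$, $P_1(x)=x-c_1$ and $$P_{n+1}(x)=(x-c_{n+1})P_n(x)-d_{n+1}(x^2+1)P_{n-1}(x),\qquad n\ge 1,$$ and rational functions by $u_0=1$, $$u_n(x)=\frac{(-1)^n}{(x-i)^n\prod_{j=1}^n\sqrt{d_{j+1}}}\,P_n(x),\qquad \hat u_n(x)=\sqrt{\ell_{n+1}}\,u_n(x)+\sqrt{1-\ell_n}\,u_{n-1}(x),\qquad n\ge 1.$$ Let $\tau_0=1$, $\tau_n=\tau_{n-1}\frac{1-ic_n}{1+ic_n}$ for $n\ge 1$, and let $\mu$ be the probability measure on the unit circle $\mathbb T$ whose Verblunsky coefficients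 $\alpha_{n-1}=-\overline{\Phi_n(0)}$ (where $\{\Phi_n\}_{n\ge0}$ are the monic orthogonal polynomials of $\mu$) are $$\alpha_{n-1}=-\frac1{\tau_n}\,\frac{1-2\ell_{n+1}-ic_{n+1}}{1-ic_{n+1}},\qquad n\ge 1.$$ Assume that $\mu(\{1\})=0$, and let $\psi$ be the measure on the real line given by $d\psi(x)=-d\mu\big(\tfrac{x+i}{x-i}\big)$, i.e. $\psi(E)=\mu\big(\{\tfrac{x+i}{x-i}:x\in E\}\big)$ for Borel sets $E\subseteq\mathbb R$. Then, for all $m,k\ge 1$, the function $\overline{\hat u_m(x)}\,\hat u_k(x)\,(x^2+1)$ is $\psi$-integrable and $$\int_{-\infty}^{\infty}\overline{\hat u_m(x)}\;\hat u_k(x)\,(x^2+1)\,d\psi(x)=(1+c_1^2)\,\delta_{m,k}.$$ -/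

import Mathlib

open MeasureTheory Polynomial
open scoped ComplexConjugate

noncomputable section

namespace RII

/-- `g` is a parameter sequence `g₁, g₂, …` of `d₂, d₃, …` (the entries `g 0`, `d 0`, `d 1` are
not used): `0 ≤ g₁ < 1`, `0 < gₙ < 1` for `n ≥ 2`, and `dₙ₊₁ = (1 - gₙ) gₙ₊₁` for `n ≥ 1`. -/
def IsParameterSequence (d g : ℕ → ℝ) : Prop :=
  (0 ≤ g 1 ∧ g 1 < 1) ∧ (∀ n, 2 ≤ n → 0 < g n ∧ g n < 1) ∧
    ∀ n, 1 ≤ n → d (n + 1) = (1 - g n) * g (n + 1)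

/-- `d₂, d₃, …` is a positive chain sequence. -/
def IsPositiveChainSequence (d : ℕ → ℝ) : Prop :=
  ∃ g, IsParameterSequence d g

/-- The minimal parameter sequence `ℓ₁, ℓ₂, …` of a positive chain sequence `d₂, d₃, …`:
`ℓ₁ = 0` and `(1 - ℓₙ) ℓₙ₊₁ = dₙ₊₁`. The value at index `0` is not used. -/
def minParam (d : ℕ → ℝ) : ℕ → ℝ
  | 0 => 0
  | 1 => 0
  | n + 2 => d (n + 2) / (1 - minParam d (n + 1))

/-- The sequence `minParam d` lies below every parameter sequence of `d`. -/
theorem minParam_le {d g : ℕ → ℝ} (hg : IsParameterSequence d g) (n : ℕ) :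
    0 ≤ minParam d (n + 1) ∧ minParam d (n + 1) ≤ g (n + 1) := by
  induction n with
  | zero => exact ⟨le_refl _, hg.1.1⟩
  | succ n ih =>
    obtain ⟨⟨h0, h1⟩, h2, h3⟩ := hg
    have hlt : g (n + 1) < 1 := by
      rcases Nat.eq_zero_or_pos n with rfl | hn
      · exact h1
      · exact (h2 (n + 1) (by omega)).2
    have hg2 := (h2 (n + 2) (by omega)).1
    have hd := h3 (n + 1) (by omega)
    have hpos : 0 < 1 - minParam d (n + 1) := by linarith [ih.2]
    change 0 ≤ d (n + 2) / (1 - minParam d (n + 1)) ∧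
      d (n + 2) / (1 - minParam d (n + 1)) ≤ g (n + 2)
    have hd' : d (n + 2) = (1 - g (n + 1)) * g (n + 2) := hd
    have hdpos : 0 < d (n + 2) := by
      rw [hd']; exact mul_pos (by linarith) hg2
    refine ⟨(div_pos hdpos hpos).le, ?_⟩
    rw [div_le_iff₀ hpos, hd']
    nlinarith [ih.2]

/-- For a positive chain sequence `d`, `minParam d` is a parameter sequence. -/
theorem isParameterSequence_minParam {d : ℕ → ℝ} (hd : IsPositiveChainSequence d) :
    IsParameterSequence d (minParam d) := by
  obtain ⟨g, hg⟩ := hd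
  have hlt : ∀ n, minParam d (n + 1) < 1 := by
    intro n
    refine lt_of_le_of_lt (minParam_le hg n).2 ?_
    rcases Nat.eq_zero_or_pos n with rfl | hn
    · exact hg.1.2
    · exact (hg.2.1 (n + 1) (by omega)).2
  have hrec : ∀ n, d (n + 2) = (1 - minParam d (n + 1)) * minParam d (n + 2) := by
    intro n
    have hne : 1 - minParam d (n + 1) ≠ 0 := by linarith [hlt n] |> ne_of_gt
    change d (n + 2) = (1 - minParam d (n + 1)) * (d (n + 2) / (1 - minParam d (n + 1)))
    field_simp
  refine ⟨⟨le_refl _, hlt 0⟩, ?_, ?_⟩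
  · intro n hn
    obtain ⟨k, rfl⟩ := Nat.exists_eq_add_of_le' hn
    refine ⟨lt_of_le_of_ne (minParam_le hg (k + 1)).1 ?_, hlt (k + 1)⟩
    intro h0
    have h1 := hrec k
    have h2 : d (k + 2) = (1 - g (k + 1)) * g (k + 2) := hg.2.2 (k + 1) (by omega)
    have h3 : 0 < g (k + 2) := (hg.2.1 (k + 2) (by omega)).1
    have h4 : g (k + 1) < 1 := by
      rcases Nat.eq_zero_or_pos k with rfl | hk
      · exact hg.1.2
      · exact (hg.2.1 (k + 1) (by omega)).2
    have h5 : 0 < (1 - g (k + 1)) * g (k + 2) := mul_pos (by linarith) h3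
    have h6 : minParam d (k + 2) = 0 := h0.symm
    rw [h6, mul_zero] at h1
    linarith
  · intro n hn
    obtain ⟨k, rfl⟩ := Nat.exists_eq_add_of_le' hn
    exact hrec k

/-- The polynomials of the special `R_II` type recurrence: `P₀ = 1`, `P₁ = x - c₁` and
`Pₙ₊₁ = (x - cₙ₊₁) Pₙ - dₙ₊₁ (x² + 1) Pₙ₋₁` for `n ≥ 1`. -/
def P (c d : ℕ → ℝ) : ℕ → ℝ[X]
  | 0 => 1
  | 1 => X - C (c 1)
  | n + 2 => (X - C (c (n + 2))) * P c d (n + 1) - C (d (n + 2)) * (X ^ 2 + 1) * P c d n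

/-- The rational functions `uₙ(x) = (-1)ⁿ Pₙ(x) / ((x - i)ⁿ ∏_{j=1}^n √dⱼ₊₁)`. -/
def u (c d : ℕ → ℝ) (n : ℕ) (x : ℝ) : ℂ :=
  (-1) ^ n / (((x : ℂ) - Complex.I) ^ n * ∏ j ∈ Finset.Icc 1 n, (√(d (j + 1)) : ℂ)) *
    (((P c d n).eval x : ℝ) : ℂ)

/-- The rational functions `û_k = √ℓ_{k+1} u_k + √(1 - ℓ_k) u_{k-1}`, for `k ≥ 1`. -/
def uHat (c d : ℕ → ℝ) (k : ℕ) (x : ℝ) : ℂ :=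
  (√(minParam d (k + 1)) : ℂ) * u c d k x + (√(1 - minParam d k) : ℂ) * u c d (k - 1) x

/-- `τ₀ = 1` and `τₙ = τₙ₋₁ (1 - i cₙ) / (1 + i cₙ)` for `n ≥ 1`. -/
def tau (c : ℕ → ℝ) : ℕ → ℂ
  | 0 => 1
  | n + 1 => tau c n * ((1 - Complex.I * c (n + 1)) / (1 + Complex.I * c (n + 1)))

/-- `αₙ₋₁ = -(1/τₙ) (1 - 2ℓₙ₊₁ - i cₙ₊₁) / (1 - i cₙ₊₁)` for `n ≥ 1`, indexed here from `0`. -/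
def alpha (c d : ℕ → ℝ) (n : ℕ) : ℂ :=
  -(1 / tau c (n + 1)) *
    ((1 - 2 * (minParam d (n + 2) : ℂ) - Complex.I * c (n + 2)) / (1 - Complex.I * c (n + 2)))

/-- The unit circle carries its Borel `σ`-algebra. -/
instance instMeasurableSpaceCircle : MeasurableSpace Circle := borel Circle

instance instBorelSpaceCircle : BorelSpace Circle := ⟨rfl⟩

/-- `Φ` is the sequence of monic orthogonal polynomials of the measure `μ` on the unit circle. -/
def IsMonicOPUC (μ : Measure Circle) (Φ : ℕ → ℂ[X]) : Prop :=
  (∀ n, (Φ n).Monic ∧ (Φ n).natDegree = n) ∧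
    ∀ m n, (∫ z : Circle, conj ((Φ m).eval (z : ℂ)) * (Φ n).eval (z : ℂ) ∂μ) = 0 ↔ m ≠ n

/-- `a` is the sequence of Verblunsky coefficients `aₙ = -conj (Φₙ₊₁ 0)` of `μ`. -/
def HasVerblunskyCoefficients (μ : Measure Circle) (a : ℕ → ℂ) : Prop :=
  ∃ Φ : ℕ → ℂ[X], IsMonicOPUC μ Φ ∧ ∀ n, a n = -conj ((Φ (n + 1)).eval 0)

theorem sub_I_ne_zero (x : ℝ) : (x : ℂ) - Complex.I ≠ 0 := by
  intro h
  have := congrArg Complex.im h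
  simp at this

/-- The map `x ↦ (x + i) / (x - i)` from the real line to the unit circle. -/
def cayley (x : ℝ) : Circle :=
  ⟨((x : ℂ) + Complex.I) / ((x : ℂ) - Complex.I), by
    have h : (x : ℂ) + Complex.I = conj ((x : ℂ) - Complex.I) := by simp
    rw [Submonoid.unitSphere, Submonoid.mem_mk, Subsemigroup.mem_mk, mem_sphere_zero_iff_norm,
      norm_div, h, Complex.norm_conj, div_self (norm_ne_zero_iff.2 (sub_I_ne_zero x))]⟩

theorem measurableEmbedding_cayley : MeasurableEmbedding cayley := by
  have hc : Continuous cayley := by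
    refine Continuous.subtype_mk ?_ _
    exact (by fun_prop : Continuous fun x : ℝ => (x : ℂ) + Complex.I).div
      (by fun_prop) sub_I_ne_zero
  refine hc.measurableEmbedding ?_
  intro x y h
  have h' := congrArg (fun z : Circle => (z : ℂ)) h
  change ((x : ℂ) + Complex.I) / ((x : ℂ) - Complex.I) =
    ((y : ℂ) + Complex.I) / ((y : ℂ) - Complex.I) at h'
  rw [div_eq_div_iff (sub_I_ne_zero x) (sub_I_ne_zero y)] at h'
  have := congrArg Complex.im h'
  simp at this
  linarith

/-- The measure `ψ` on the real line with `dψ(x) = -dμ((x + i)/(x - i))`. As `x` increases, the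
point `(x + i)/(x - i)` runs clockwise through the circle, which is the reason for the sign: `ψ` is
the positive measure with `ψ(E) = μ {(x + i)/(x - i) : x ∈ E}`. -/
def psi (μ : Measure Circle) : Measure ℝ :=
  μ.comap cayley

theorem psi_apply (μ : Measure Circle) (E : Set ℝ) : psi μ E = μ (cayley '' E) :=
  measurableEmbedding_cayley.comap_apply μ E

end RII

end

/-! The Cayley transform ζ = (x+i)/(x-i) turns `uHat` into orthogonal polynomials on the circle:
(x-i) û_{n+1}(x) = κ_n Φ_n(ζ) for a constant κ_n (`sub_I_mul_uHat`). Since x²+1 = |x-i|², the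
integrand is conj κ_m κ_k times conj Φ_m Φ_k at ζ, with indices lowered by one. As μ has no mass at
1, the only point the transform misses, ψ pushes forward to μ (`map_psi`), and orthogonality is that
of the Φ_n.

The proportionality comes from comparing two recurrences. On the line, Szegő's recurrence
(`IsMonicOPUC.szego`) links F_n = (x-i)^n Φ_n(ζ) to F_n and its conjugate (`szego_cayley`). As P_n
is real, both are combinations of P_{n+1} and P_n, and the chosen α_n makes the result the R_II
recurrence (`eval_P_succ_sub`).

For the norms, ‖Φ_{n+1}‖² = (1-|α_n|²)‖Φ_n‖², while |κ_n|² grows by exactly the inverse factor, so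
|κ_n|²‖Φ_n‖² keeps its initial value 1 + c₁². -/

namespace RII

/-! ### The inner product of a circle measure and reversed polynomials -/

/-- The sesquilinear form `∫ conj p · q dμ` on polynomials. -/
noncomputable def circleInner (μ : Measure Circle) (p q : ℂ[X]) : ℂ :=
  ∫ z : Circle, conj (p.eval (z : ℂ)) * q.eval (z : ℂ) ∂μ

theorem integrable_conj_eval_mul_eval (μ : Measure Circle) [IsProbabilityMeasure μ] (p q : ℂ[X]) :
    Integrable (fun z : Circle => conj (p.eval (z : ℂ)) * q.eval (z : ℂ)) μ := by
  refine Continuous.integrable_of_hasCompactSupport ?_ (HasCompactSupport.of_compactSpace _)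
  have hp : Continuous fun z : Circle => p.eval (z : ℂ) := p.continuous.comp continuous_subtype_val
  have hq : Continuous fun z : Circle => q.eval (z : ℂ) := q.continuous.comp continuous_subtype_val
  exact (Complex.continuous_conj.comp hp).mul hq

theorem conj_coe_mul_coe (z : Circle) : conj (z : ℂ) * (z : ℂ) = 1 := by
  rw [mul_comm, Complex.mul_conj, Circle.normSq_coe, Complex.ofReal_one]

section CircleInner

variable (μ : Measure Circle)

theorem conj_circleInner (p q : ℂ[X]) : conj (circleInner μ p q) = circleInner μ q p := by
  rw [circleInner, circleInner, ← integral_conj]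
  congr 1; ext z
  simp [mul_comm]

theorem circleInner_C_mul_right (a : ℂ) (p q : ℂ[X]) :
    circleInner μ p (C a * q) = a * circleInner μ p q := by
  rw [circleInner, circleInner, ← integral_const_mul]
  congr 1; ext z
  rw [eval_mul, eval_C]; ring

theorem circleInner_C_mul_left (a : ℂ) (p q : ℂ[X]) :
    circleInner μ (C a * p) q = conj a * circleInner μ p q := by
  rw [← conj_circleInner, circleInner_C_mul_right, map_mul, conj_circleInner]

theorem circleInner_X_mul_X_mul (p q : ℂ[X]) :
    circleInner μ (X * p) (X * q) = circleInner μ p q := by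
  rw [circleInner, circleInner]
  congr 1; ext z
  simp only [eval_mul, eval_X, map_mul]
  linear_combination (conj (p.eval (z : ℂ)) * q.eval (z : ℂ)) * conj_coe_mul_coe z

variable [IsProbabilityMeasure μ]

theorem circleInner_add_right (p q r : ℂ[X]) :
    circleInner μ p (q + r) = circleInner μ p q + circleInner μ p r := by
  rw [circleInner, circleInner, circleInner, ← integral_add
    (integrable_conj_eval_mul_eval μ p q) (integrable_conj_eval_mul_eval μ p r)]
  congr 1; ext z
  rw [eval_add]; ring

theorem circleInner_sub_right (p q r : ℂ[X]) :
    circleInner μ p (q - r) = circleInner μ p q - circleInner μ p r := by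
  have h := circleInner_add_right μ p (q - r) r
  rw [sub_add_cancel] at h
  rw [h]; ring

theorem circleInner_add_left (p q r : ℂ[X]) :
    circleInner μ (p + q) r = circleInner μ p r + circleInner μ q r := by
  rw [← conj_circleInner, circleInner_add_right, map_add, conj_circleInner, conj_circleInner]

end CircleInner

/-- The reversed polynomial `p⋆(z) = zᴺ conj (p (1 / conj z))`. -/
noncomputable def sharp (N : ℕ) (p : ℂ[X]) : ℂ[X] :=
  reflect N (p.map (starRingEnd ℂ))

theorem eval_sharp {N : ℕ} {p : ℂ[X]} (hp : p.natDegree ≤ N) (z : Circle) :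
    (sharp N p).eval (z : ℂ) = (z : ℂ) ^ N * conj (p.eval (z : ℂ)) := by
  have hz : (z : ℂ) * conj (z : ℂ) = 1 := by rw [mul_comm]; exact conj_coe_mul_coe z
  let _ : Invertible (conj (z : ℂ)) := ⟨z, hz, conj_coe_mul_coe z⟩
  have h := eval₂_reflect_mul_pow (RingHom.id ℂ) (conj (z : ℂ)) N (p.map (starRingEnd ℂ))
    ((natDegree_map_le).trans hp)
  change (sharp N p).eval (z : ℂ) * conj (z : ℂ) ^ N =
    (p.map (starRingEnd ℂ)).eval (conj (z : ℂ)) at h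
  rw [eval_map, eval₂_hom] at h
  rw [← h, mul_comm, mul_assoc, ← mul_pow, conj_coe_mul_coe, one_pow, mul_one]

theorem coeff_sharp_of_lt {N : ℕ} {p : ℂ[X]} (hp : p.natDegree ≤ N) {j : ℕ} (hj : N < j) :
    (sharp N p).coeff j = 0 := by
  rw [sharp, coeff_reflect, revAt_eq_self_of_lt hj, coeff_map,
    coeff_eq_zero_of_natDegree_lt (by omega), map_zero]

theorem coeff_zero_sharp (N : ℕ) (p : ℂ[X]) : (sharp N p).coeff 0 = conj (p.coeff N) := by
  rw [sharp, coeff_reflect, revAt_le (Nat.zero_le N), Nat.sub_zero, coeff_map]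

/-! ### Szegő recurrence and norms of monic orthogonal polynomials -/

namespace IsMonicOPUC

variable {μ : Measure Circle} {Φ : ℕ → ℂ[X]}

theorem coeff_self (h : IsMonicOPUC μ Φ) (n : ℕ) : (Φ n).coeff n = 1 := by
  have h1 := (h.1 n).1
  rw [Monic, leadingCoeff, (h.1 n).2] at h1
  exact h1

theorem coeff_of_lt (h : IsMonicOPUC μ Φ) {n j : ℕ} (hj : n < j) : (Φ n).coeff j = 0 :=
  coeff_eq_zero_of_natDegree_lt (by rw [(h.1 n).2]; exact hj)

theorem eq_one (h : IsMonicOPUC μ Φ) : Φ 0 = 1 :=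
  (h.1 0).1.natDegree_eq_zero.1 (h.1 0).2

theorem degree_sub_lt (h : IsMonicOPUC μ Φ) {q : ℂ[X]} {m : ℕ} (hq : q.degree < (m + 1 : ℕ)) :
    (q - C (q.coeff m) * Φ m).degree < m := by
  rw [degree_lt_iff_coeff_zero] at hq ⊢
  intro j hj
  rw [coeff_sub, coeff_C_mul]
  rcases hj.eq_or_lt with rfl | hj
  · rw [h.coeff_self, mul_one, sub_self]
  · rw [h.coeff_of_lt hj, hq j hj, mul_zero, sub_self]

variable [IsProbabilityMeasure μ]

theorem circleInner_eq_zero_of_degree_lt (h : IsMonicOPUC μ Φ) {n : ℕ} {q : ℂ[X]}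
    (hq : q.degree < n) : circleInner μ q (Φ n) = 0 := by
  suffices H : ∀ m ≤ n, ∀ q : ℂ[X], q.degree < m → circleInner μ q (Φ n) = 0 from H n le_rfl q hq
  intro m
  induction m with
  | zero =>
    intro _ q hq
    have : q = 0 := by
      ext j
      exact (degree_lt_iff_coeff_zero q 0).1 hq j (Nat.zero_le j)
    simp [this, circleInner]
  | succ m ih =>
    intro hm q hq
    have h0 : circleInner μ (Φ m) (Φ n) = 0 := (h.2 m n).2 (by omega)
    rw [← sub_add_cancel q (C (q.coeff m) * Φ m), circleInner_add_left, circleInner_C_mul_left, h0,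
      ih (by omega) _ (h.degree_sub_lt hq), mul_zero, add_zero]

theorem eq_zero_of_orthogonal (h : IsMonicOPUC μ Φ) {n : ℕ} {p : ℂ[X]} (hp : p.degree < n)
    (ho : ∀ q : ℂ[X], q.degree < n → circleInner μ q p = 0) : p = 0 := by
  by_contra hne
  have hlt : p.natDegree < n := (natDegree_lt_iff_degree_lt hne).2 hp
  have hdeg : p.degree < (p.natDegree + 1 : ℕ) := by
    rw [degree_eq_natDegree hne]; exact_mod_cast Nat.lt_succ_self _
  set m := p.natDegree with hm
  have hΦ : (Φ m).degree < n := by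
    rw [degree_eq_natDegree (h.1 m).1.ne_zero, (h.1 m).2]; exact_mod_cast hlt
  have h1 : circleInner μ (Φ m) p = p.coeff m * circleInner μ (Φ m) (Φ m) := by
    conv_lhs => rw [← sub_add_cancel p (C (p.coeff m) * Φ m)]
    rw [circleInner_add_right, circleInner_C_mul_right,
      ← conj_circleInner, h.circleInner_eq_zero_of_degree_lt (h.degree_sub_lt hdeg), map_zero,
      zero_add]
  rw [ho _ hΦ] at h1
  -- Nondegeneracy is the diagonal case of the equivalence in `IsMonicOPUC`; no separate condition
  -- on the support of μ is needed.
  have h2 : circleInner μ (Φ m) (Φ m) ≠ 0 := fun h0 => (h.2 m m).1 h0 rfl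
  have h3 : p.coeff m ≠ 0 := leadingCoeff_ne_zero.2 hne
  exact mul_ne_zero h3 h2 h1.symm

/-- Reversal swaps the two arguments: on the circle the integrand equals conj Φ_n times the reversal
of q at degree n-1, which has degree below n. -/
theorem circleInner_X_mul_sharp (h : IsMonicOPUC μ Φ) {n : ℕ} {q : ℂ[X]} (hq : q.degree < n) :
    circleInner μ (X * q) (sharp n (Φ n)) = 0 := by
  obtain _ | n := n
  · have : q = 0 := by
      ext j
      exact (degree_lt_iff_coeff_zero q 0).1 hq j (Nat.zero_le j)
    simp [this, circleInner]
  have hqn : q.natDegree ≤ n := by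
    refine natDegree_le_iff_coeff_eq_zero.2 fun j hj => ?_
    exact (degree_lt_iff_coeff_zero q _).1 hq j hj
  have h1 : circleInner μ (X * q) (sharp (n + 1) (Φ (n + 1))) =
      circleInner μ (Φ (n + 1)) (sharp n q) := by
    rw [circleInner, circleInner]
    congr 1; ext z
    rw [eval_sharp (h.1 _).2.le, eval_sharp hqn, eval_mul, eval_X, map_mul]
    linear_combination ((z : ℂ) ^ n * conj (q.eval (z : ℂ)) * conj ((Φ (n + 1)).eval (z : ℂ))) *
      conj_coe_mul_coe z
  rw [h1, ← conj_circleInner, h.circleInner_eq_zero_of_degree_lt, map_zero]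
  rw [degree_lt_iff_coeff_zero]
  exact fun j hj => coeff_sharp_of_lt hqn hj

/-- The Szegő recurrence. -/
theorem szego (h : IsMonicOPUC μ Φ) (n : ℕ) :
    Φ (n + 1) = X * Φ n + C ((Φ (n + 1)).eval 0) * sharp n (Φ n) := by
  set a := (Φ (n + 1)).eval 0 with ha
  -- The defect D vanishes at 0 and its top coefficient cancels, so D = X E with deg E < n.
  -- Multiplication by X is isometric and each term of D is orthogonal to X q for deg q < n, so E is
  -- orthogonal to its own space and vanishes.
  set D := Φ (n + 1) - X * Φ n - C a * sharp n (Φ n) with hD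
  have hD0 : D.coeff 0 = 0 := by
    rw [hD, coeff_sub, coeff_sub, coeff_C_mul, coeff_zero_sharp, h.coeff_self, mul_coeff_zero,
      coeff_X_zero, coeff_zero_eq_eval_zero (Φ (n + 1)), ← ha, map_one]
    ring
  have hXE : X * D.divX = D := by
    have := X_mul_divX_add D
    rwa [hD0, C_0, add_zero] at this
  have hE : D.divX.degree < n := by
    rw [degree_lt_iff_coeff_zero]
    intro j hj
    rw [coeff_divX, hD, coeff_sub, coeff_sub, coeff_C_mul, coeff_X_mul,
      coeff_sharp_of_lt (h.1 n).2.le (by omega)]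
    rcases hj.eq_or_lt with rfl | hj
    · rw [h.coeff_self, h.coeff_self]; ring
    · rw [h.coeff_of_lt hj, h.coeff_of_lt (by omega)]; ring
  have hE0 : D.divX = 0 := by
    refine h.eq_zero_of_orthogonal hE fun q hq => ?_
    have hXq : (X * q).degree < ((n + 1 : ℕ) : WithBot ℕ) := by
      rw [degree_lt_iff_coeff_zero] at hq ⊢
      rintro (_ | j) hj
      · simp
      · rw [coeff_X_mul]; exact hq j (by omega)
    rw [← circleInner_X_mul_X_mul, hXE, hD, circleInner_sub_right, circleInner_sub_right,
      circleInner_C_mul_right, circleInner_X_mul_X_mul, h.circleInner_X_mul_sharp hq,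
      h.circleInner_eq_zero_of_degree_lt hq, h.circleInner_eq_zero_of_degree_lt hXq]
    ring
  rw [hE0, mul_zero] at hXE
  linear_combination -hXE

/-- Pythagoras for X Φ_n = Φ_{n+1} - a Φ_n⋆, with a = Φ_{n+1}(0): the summands are orthogonal by
degree, and X Φ_n and Φ_n⋆ both have the norm of Φ_n. -/
theorem circleInner_self_succ (h : IsMonicOPUC μ Φ) (n : ℕ) :
    circleInner μ (Φ (n + 1)) (Φ (n + 1)) =
      (1 - conj ((Φ (n + 1)).eval 0) * (Φ (n + 1)).eval 0) * circleInner μ (Φ n) (Φ n) := by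
  have hdeg : (sharp n (Φ n)).degree < ((n + 1 : ℕ) : WithBot ℕ) := by
    rw [degree_lt_iff_coeff_zero]
    exact fun j hj => coeff_sharp_of_lt (h.1 n).2.le hj
  have h1 := h.circleInner_eq_zero_of_degree_lt hdeg
  have h2 : circleInner μ (Φ (n + 1)) (sharp n (Φ n)) = 0 := by
    rw [← conj_circleInner, h1, map_zero]
  have h3 : circleInner μ (sharp n (Φ n)) (sharp n (Φ n)) = circleInner μ (Φ n) (Φ n) := by
    rw [circleInner, circleInner]
    congr 1; ext z
    rw [eval_sharp (h.1 n).2.le, map_mul, map_pow, Complex.conj_conj]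
    have hz : conj (z : ℂ) ^ n * (z : ℂ) ^ n = 1 := by
      rw [← mul_pow, conj_coe_mul_coe, one_pow]
    linear_combination ((Φ n).eval (z : ℂ) * conj ((Φ n).eval (z : ℂ))) * hz
  have h4 := circleInner_X_mul_X_mul μ (Φ n) (Φ n)
  set a := (Φ (n + 1)).eval 0 with ha
  have hX : X * Φ n = Φ (n + 1) + C (-a) * sharp n (Φ n) := by
    rw [C_neg]; linear_combination -h.szego n
  rw [hX, circleInner_add_left, circleInner_add_right, circleInner_add_right,
    circleInner_C_mul_left, circleInner_C_mul_left, circleInner_C_mul_right,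
    circleInner_C_mul_right, h1, h2, h3, map_neg] at h4
  linear_combination h4

end IsMonicOPUC

end RII

/-! ### Chain sequence parameters and Verblunsky coefficients -/

namespace RII

theorem minParam_one (d : ℕ → ℝ) : minParam d 1 = 0 := rfl

section ChainSequence

variable {d : ℕ → ℝ}

theorem minParam_lt_one (hd : IsPositiveChainSequence d) (n : ℕ) : minParam d (n + 1) < 1 := by
  have h := isParameterSequence_minParam hd
  obtain _ | n := n
  · exact h.1.2
  · exact (h.2.1 (n + 2) (by omega)).2

theorem minParam_pos (hd : IsPositiveChainSequence d) (n : ℕ) : 0 < minParam d (n + 2) :=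
  ((isParameterSequence_minParam hd).2.1 (n + 2) (by omega)).1

theorem eq_one_sub_minParam_mul (hd : IsPositiveChainSequence d) (n : ℕ) :
    d (n + 2) = (1 - minParam d (n + 1)) * minParam d (n + 2) :=
  (isParameterSequence_minParam hd).2.2 (n + 1) (by omega)

end ChainSequence

/-- The product `∏_{j=1}^n (1 + i cⱼ)`. -/
noncomputable def prodOneAdd (c : ℕ → ℝ) : ℕ → ℂ
  | 0 => 1
  | n + 1 => prodOneAdd c n * (1 + Complex.I * c (n + 1))

theorem prodOneAdd_add_two (c : ℕ → ℝ) (n : ℕ) :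
    prodOneAdd c (n + 2) = prodOneAdd c (n + 1) * (1 + Complex.I * c (n + 2)) := rfl

theorem one_add_I_mul_ne_zero (t : ℝ) : (1 : ℂ) + Complex.I * t ≠ 0 := by
  intro h
  have := congrArg Complex.re h
  simp at this

theorem prodOneAdd_ne_zero (c : ℕ → ℝ) (n : ℕ) : prodOneAdd c n ≠ 0 := by
  induction n with
  | zero => exact one_ne_zero
  | succ n ih => exact mul_ne_zero ih (one_add_I_mul_ne_zero _)

theorem tau_eq (c : ℕ → ℝ) (n : ℕ) : tau c n = conj (prodOneAdd c n) / prodOneAdd c n := by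
  induction n with
  | zero => simp [tau, prodOneAdd]
  | succ n ih =>
    have h1 := prodOneAdd_ne_zero c n
    have h2 := one_add_I_mul_ne_zero (c (n + 1))
    rw [tau, prodOneAdd, ih, map_mul, map_add, map_mul, map_one, Complex.conj_I,
      Complex.conj_ofReal]
    field_simp
    ring

theorem conj_alpha_mul_prodOneAdd (c d : ℕ → ℝ) (n : ℕ) :
    conj (alpha c d n) * prodOneAdd c (n + 2) =
      -conj (prodOneAdd c (n + 1)) * (1 - 2 * minParam d (n + 2) + Complex.I * c (n + 2)) := by
  have h1 := prodOneAdd_ne_zero c (n + 1)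
  have h1' : conj (prodOneAdd c (n + 1)) ≠ 0 := (_root_.map_ne_zero _).2 h1
  have h2 := one_add_I_mul_ne_zero (c (n + 2))
  rw [alpha, tau_eq, prodOneAdd_add_two]
  simp only [map_mul, map_neg, map_div₀, map_sub, map_one, Complex.conj_I, Complex.conj_ofReal,
    Complex.conj_conj, map_ofNat, neg_mul, sub_neg_eq_add]
  field_simp

/-- Since |τ| = 1, |α_n|² (1+c²) = (1-2ℓ)² + c², and 1 - (1-2ℓ)² = 4ℓ(1-ℓ). -/
theorem one_sub_conj_alpha_mul_alpha (c d : ℕ → ℝ) (n : ℕ) :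
    (1 - alpha c d n * conj (alpha c d n)) * (1 + (c (n + 2) : ℂ) ^ 2) =
      4 * (minParam d (n + 2) * (1 - minParam d (n + 2))) := by
  have h1 := prodOneAdd_ne_zero c (n + 1)
  have h1' : conj (prodOneAdd c (n + 1)) ≠ 0 := (_root_.map_ne_zero _).2 h1
  have h := conj_alpha_mul_prodOneAdd c d n
  have h' := congrArg conj h
  rw [prodOneAdd_add_two] at h h'
  simp only [map_mul, map_neg, map_add, map_sub, map_one, Complex.conj_I, Complex.conj_ofReal,
    Complex.conj_conj, map_ofNat] at h'
  have key : (alpha c d n * conj (alpha c d n)) * (1 + (c (n + 2) : ℂ) ^ 2) =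
      (1 - 2 * minParam d (n + 2)) ^ 2 + (c (n + 2) : ℂ) ^ 2 := by
    refine mul_left_cancel₀ (mul_ne_zero h1 h1') ?_
    have h2 := congrArg₂ (· * ·) h h'
    linear_combination h2 + (alpha c d n * conj (alpha c d n) - 1) * prodOneAdd c (n + 1) *
      conj (prodOneAdd c (n + 1)) * (c (n + 2) : ℂ) ^ 2 * Complex.I_sq
  linear_combination -key

theorem coe_cayley (x : ℝ) :
    (cayley x : ℂ) = ((x : ℂ) + Complex.I) / ((x : ℂ) - Complex.I) := rfl

theorem conj_sub_I (x : ℝ) : conj ((x : ℂ) - Complex.I) = (x : ℂ) + Complex.I := by simp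

/-! ### From the Szegő recurrence to the R_II recurrence -/

section Recurrence

variable {μ : Measure Circle} [IsProbabilityMeasure μ] {Φ : ℕ → ℂ[X]}

/-- The Szegő recurrence, carried to the real line by the Cayley transform. -/
theorem IsMonicOPUC.szego_cayley (h : IsMonicOPUC μ Φ) (n : ℕ) (x : ℝ) :
    ((x : ℂ) - Complex.I) ^ (n + 1) * (Φ (n + 1)).eval (cayley x : ℂ) =
      ((x : ℂ) + Complex.I) * (((x : ℂ) - Complex.I) ^ n * (Φ n).eval (cayley x : ℂ)) +
        (Φ (n + 1)).eval 0 * ((x : ℂ) - Complex.I) *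
          conj (((x : ℂ) - Complex.I) ^ n * (Φ n).eval (cayley x : ℂ)) := by
  have hw := sub_I_ne_zero x
  conv_lhs => rw [h.szego n]
  rw [eval_add, eval_mul, eval_mul, eval_X, eval_C, eval_sharp (h.1 n).2.le, map_mul, map_pow,
    conj_sub_I]
  have h1 : ((x : ℂ) - Complex.I) * (cayley x : ℂ) = (x : ℂ) + Complex.I := by
    rw [coe_cayley, mul_div_cancel₀ _ hw]
  have h2 : ((x : ℂ) - Complex.I) ^ n * (cayley x : ℂ) ^ n = ((x : ℂ) + Complex.I) ^ n := by
    rw [← mul_pow, h1]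
  linear_combination (((x : ℂ) - Complex.I) ^ n * (Φ n).eval (cayley x : ℂ)) * h1 +
    ((Φ (n + 1)).eval 0 * ((x : ℂ) - Complex.I) * conj ((Φ n).eval (cayley x : ℂ))) * h2

theorem eval_P_succ_sub (c : ℕ → ℝ) {d : ℕ → ℝ} (hd : IsPositiveChainSequence d)
    (h : IsMonicOPUC μ Φ) (hα : ∀ n, alpha c d n = -conj ((Φ (n + 1)).eval 0)) (n : ℕ) (x : ℝ) :
    2 ^ n * ((((P c d (n + 1)).eval x : ℝ) : ℂ) -
      (1 - minParam d (n + 1)) * ((x : ℂ) - Complex.I) * (((P c d n).eval x : ℝ) : ℂ)) =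
    Complex.I * prodOneAdd c (n + 1) *
      (((x : ℂ) - Complex.I) ^ n * (Φ n).eval (cayley x : ℂ)) := by
  induction n with
  | zero =>
    simp [h.eq_one, P, minParam_one, prodOneAdd]
    linear_combination (-(c 1 : ℂ)) * Complex.I_sq
  | succ n ih =>
    -- The values of P are real, so conjugation only turns x-i into x+i on the left and supplies the
    -- conjugate term of the Szegő recurrence.
    have ih' := congrArg conj ih
    simp only [map_mul, map_sub, map_one, map_ofNat, Complex.conj_ofReal, Complex.conj_I,
      sub_neg_eq_add, map_pow] at ih'
    have hrec : (((P c d (n + 2)).eval x : ℝ) : ℂ) =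
        ((x : ℂ) - c (n + 2)) * (((P c d (n + 1)).eval x : ℝ) : ℂ) -
        (1 - minParam d (n + 1)) * minParam d (n + 2) * ((x : ℂ) ^ 2 + 1) *
          (((P c d n).eval x : ℝ) : ℂ) := by
      rw [P, eq_one_sub_minParam_mul hd]
      simp
    have hA := conj_alpha_mul_prodOneAdd c d n
    rw [hα n, map_neg, Complex.conj_conj] at hA
    rw [h.szego_cayley n x, hrec]
    simp only [map_mul, map_sub, map_pow, Complex.conj_ofReal, Complex.conj_I, sub_neg_eq_add]
    generalize ((x : ℂ) - Complex.I) ^ n * (Φ n).eval (cayley x : ℂ) = F at ih ⊢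
    generalize ((x : ℂ) + Complex.I) ^ n * conj ((Φ n).eval (cayley x : ℂ)) = G at ih' ⊢
    generalize (((P c d (n + 1)).eval x : ℝ) : ℂ) = p at ih ih' ⊢
    generalize (((P c d n).eval x : ℝ) : ℂ) = q at ih ih' ⊢
    have e1 : Complex.I * prodOneAdd c (n + 2) * (((x : ℂ) + Complex.I) * F +
        (Φ (n + 1)).eval 0 * ((x : ℂ) - Complex.I) * G) =
        (1 + Complex.I * c (n + 2)) * ((x : ℂ) + Complex.I) *
          (Complex.I * prodOneAdd c (n + 1) * F) -
        (1 - 2 * minParam d (n + 2) + Complex.I * c (n + 2)) * ((x : ℂ) - Complex.I) *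
          (-Complex.I * conj (prodOneAdd c (n + 1)) * G) := by
      linear_combination (Complex.I * ((x : ℂ) + Complex.I) * F) * prodOneAdd_add_two c n -
        (Complex.I * ((x : ℂ) - Complex.I) * G) * hA
    -- With c = c_{n+2}, ℓ = ℓ_{n+2}, the coefficient of P_{n+1} is 2^n times (1+ic)(x+i) -
    -- (1-2ℓ+ic)(x-i) = 2((x-c) - (1-ℓ)(x-i)), whence the powers of 2. In the coefficient of P_n
    -- only 2ℓ(x²+1) survives from the bracket, giving the term in d_{n+2}.
    rw [show n + 1 + 1 = n + 2 from rfl, e1, ← ih, ← ih', pow_succ]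
    ring_nf
    rw [Complex.I_sq]
    ring

/-- The factor of proportionality between `(x - i) û_{n+1}` and the monic orthogonal
polynomial `Φₙ`. -/
noncomputable def kappa (c d : ℕ → ℝ) (n : ℕ) : ℂ :=
  (-1) ^ (n + 1) * Complex.I * prodOneAdd c (n + 1) /
    (2 ^ n * √(1 - minParam d (n + 1)) * ∏ j ∈ Finset.Icc 1 n, (√(d (j + 1)) : ℂ))

theorem prod_sqrt_ne_zero {d : ℕ → ℝ} (hd : IsPositiveChainSequence d) (n : ℕ) :
    ∏ j ∈ Finset.Icc 1 n, (√(d (j + 1)) : ℂ) ≠ 0 := by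
  refine Finset.prod_ne_zero_iff.2 fun j hj => ?_
  obtain ⟨j, rfl⟩ := Nat.exists_eq_add_of_le' (Finset.mem_Icc.1 hj).1
  refine Complex.ofReal_ne_zero.2 (Real.sqrt_ne_zero'.2 ?_)
  rw [eq_one_sub_minParam_mul hd j]
  exact mul_pos (sub_pos.2 (minParam_lt_one hd j)) (minParam_pos hd j)

theorem sqrt_eq_mul {d : ℕ → ℝ} (hd : IsPositiveChainSequence d) (n : ℕ) :
    √(d (n + 2)) = √(1 - minParam d (n + 1)) * √(minParam d (n + 2)) := by
  rw [eq_one_sub_minParam_mul hd, Real.sqrt_mul (sub_pos.2 (minParam_lt_one hd n)).le]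

/-- Because √d_{n+2} = √(1-ℓ_{n+1}) √ℓ_{n+2}, the weights in `uHat` produce exactly the combination
P_{n+1} - (1-ℓ_{n+1})(x-i) P_n of `eval_P_succ_sub`. -/
theorem sub_I_mul_uHat (c : ℕ → ℝ) {d : ℕ → ℝ} (hd : IsPositiveChainSequence d)
    (h : IsMonicOPUC μ Φ) (hα : ∀ n, alpha c d n = -conj ((Φ (n + 1)).eval 0)) (n : ℕ) (x : ℝ) :
    ((x : ℂ) - Complex.I) * uHat c d (n + 1) x = kappa c d n * (Φ n).eval (cayley x : ℂ) := by
  have hw := sub_I_ne_zero x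
  have hD := prod_sqrt_ne_zero hd n
  have hs : (√(1 - minParam d (n + 1)) : ℂ) ≠ 0 :=
    Complex.ofReal_ne_zero.2 (Real.sqrt_ne_zero'.2 (sub_pos.2 (minParam_lt_one hd n)))
  have ht : (√(minParam d (n + 2)) : ℂ) ≠ 0 :=
    Complex.ofReal_ne_zero.2 (Real.sqrt_ne_zero'.2 (minParam_pos hd n))
  have hss : (√(1 - minParam d (n + 1)) : ℂ) ^ 2 = 1 - minParam d (n + 1) := by
    rw [← Complex.ofReal_pow, Real.sq_sqrt (sub_pos.2 (minParam_lt_one hd n)).le]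
    push_cast; rfl
  have key := eval_P_succ_sub c hd h hα n x
  rw [uHat, Nat.add_sub_cancel, u, u, kappa, Finset.prod_Icc_succ_top (by omega),
    show n + 1 + 1 = n + 2 from rfl, sqrt_eq_mul hd, Complex.ofReal_mul]
  rw [← hss] at key
  generalize (((P c d (n + 1)).eval x : ℝ) : ℂ) = p at key ⊢
  generalize (((P c d n).eval x : ℝ) : ℂ) = q at key ⊢
  generalize ∏ j ∈ Finset.Icc 1 n, (√(d (j + 1)) : ℂ) = D at hD ⊢
  generalize (√(1 - minParam d (n + 1)) : ℂ) = s at hs key ⊢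
  generalize (√(minParam d (n + 2)) : ℂ) = t at ht ⊢
  have e : ((x : ℂ) - Complex.I) * (t * ((-1) ^ (n + 1) / (((x : ℂ) - Complex.I) ^ (n + 1) *
      (D * (s * t))) * p) + s * ((-1) ^ n / (((x : ℂ) - Complex.I) ^ n * D) * q)) =
      (-1) ^ (n + 1) / (((x : ℂ) - Complex.I) ^ n * D * s * 2 ^ n) *
        (2 ^ n * (p - s ^ 2 * ((x : ℂ) - Complex.I) * q)) := by
    field_simp
    ring
  rw [e, key]
  field_simp

theorem conj_kappa_mul_kappa_succ (c : ℕ → ℝ) {d : ℕ → ℝ} (hd : IsPositiveChainSequence d)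
    (n : ℕ) :
    conj (kappa c d (n + 1)) * kappa c d (n + 1) *
        (4 * (minParam d (n + 2) * (1 - minParam d (n + 2)))) =
      conj (kappa c d n) * kappa c d n * (1 + (c (n + 2) : ℂ) ^ 2) := by
  have hD := prod_sqrt_ne_zero hd n
  have hs : (√(1 - minParam d (n + 1)) : ℂ) ≠ 0 :=
    Complex.ofReal_ne_zero.2 (Real.sqrt_ne_zero'.2 (sub_pos.2 (minParam_lt_one hd n)))
  have hr : (√(1 - minParam d (n + 2)) : ℂ) ≠ 0 :=
    Complex.ofReal_ne_zero.2 (Real.sqrt_ne_zero'.2 (sub_pos.2 (minParam_lt_one hd (n + 1))))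
  have ht : (√(minParam d (n + 2)) : ℂ) ≠ 0 :=
    Complex.ofReal_ne_zero.2 (Real.sqrt_ne_zero'.2 (minParam_pos hd n))
  have hrr : (1 : ℂ) - minParam d (n + 2) = (√(1 - minParam d (n + 2)) : ℂ) ^ 2 := by
    rw [← Complex.ofReal_pow, Real.sq_sqrt (sub_pos.2 (minParam_lt_one hd (n + 1))).le]
    push_cast; rfl
  have htt : (minParam d (n + 2) : ℂ) = (√(minParam d (n + 2)) : ℂ) ^ 2 := by
    rw [← Complex.ofReal_pow, Real.sq_sqrt (minParam_pos hd n).le]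
  -- The factor √(1-ℓ_{n+1}) of √d_{n+2} cancels against the one in the denominator of κ_n.
  have hk : kappa c d (n + 1) * (2 * √(1 - minParam d (n + 2)) * √(minParam d (n + 2))) =
      -(1 + Complex.I * c (n + 2)) * kappa c d n := by
    rw [kappa, kappa, Finset.prod_Icc_succ_top (by omega), prodOneAdd,
      show n + 1 + 1 = n + 2 from rfl, sqrt_eq_mul hd, Complex.ofReal_mul]
    field_simp
    ring
  have hk' := congrArg conj hk
  simp only [map_mul, map_neg, map_add, map_one, Complex.conj_I, Complex.conj_ofReal,
    map_ofNat] at hk'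
  have h2 := congrArg₂ (· * ·) hk' hk
  rw [hrr, htt]
  linear_combination h2 - (conj (kappa c d n) * kappa c d n * (c (n + 2) : ℂ) ^ 2) * Complex.I_sq

theorem conj_kappa_mul_kappa_mul_circleInner (c : ℕ → ℝ) {d : ℕ → ℝ}
    (hd : IsPositiveChainSequence d) (h : IsMonicOPUC μ Φ)
    (hα : ∀ n, alpha c d n = -conj ((Φ (n + 1)).eval 0)) (n : ℕ) :
    conj (kappa c d n) * kappa c d n * circleInner μ (Φ n) (Φ n) = 1 + (c 1 : ℂ) ^ 2 := by
  induction n with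
  | zero =>
    have : circleInner μ (Φ 0) (Φ 0) = 1 := by simp [circleInner, h.eq_one]
    rw [this]
    simp [kappa, prodOneAdd, minParam_one]
    linear_combination (-1 + (c 1 : ℂ) ^ 2 * (Complex.I ^ 2 - 1)) * Complex.I_sq
  | succ n ih =>
    have h1 := conj_kappa_mul_kappa_succ c hd n
    have h2 := one_sub_conj_alpha_mul_alpha c d n
    rw [hα n, map_neg, Complex.conj_conj] at h2
    have h3 : (1 + (c (n + 2) : ℂ) ^ 2) ≠ 0 := by
      have : (0 : ℝ) < 1 + c (n + 2) ^ 2 := by positivity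
      exact_mod_cast this.ne'
    rw [h.circleInner_self_succ, ← ih]
    refine mul_right_cancel₀ h3 ?_
    linear_combination (circleInner μ (Φ n) (Φ n)) * h1 +
      (conj (kappa c d (n + 1)) * kappa c d (n + 1) * circleInner μ (Φ n) (Φ n)) * h2

end Recurrence

/-! ### Transfer of the measure from the circle to the line -/

theorem range_cayley : Set.range cayley = {1}ᶜ := by
  ext z
  rw [Set.mem_compl_singleton_iff]
  constructor
  · rintro ⟨x, rfl⟩ h
    have h1 := congrArg (fun z : Circle => (z : ℂ)) h
    simp only [coe_cayley, Circle.coe_one] at h1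
    rw [div_eq_one_iff_eq (sub_I_ne_zero x)] at h1
    have := congrArg Complex.im h1
    norm_num at this
  · intro hz
    have hz1 : (z : ℂ) - 1 ≠ 0 := fun h => hz (Circle.ext (by simpa using sub_eq_zero.1 h))
    have hzz : conj (z : ℂ) * z = 1 := conj_coe_mul_coe z
    have hzc : conj (z : ℂ) - 1 ≠ 0 := by
      have := (_root_.map_ne_zero (starRingEnd ℂ)).2 hz1
      simpa using this
    -- The preimage of z is i(z+1)/(z-1), which is real because conj z = 1/z.
    have hreal : conj (Complex.I * (z + 1) / (z - 1)) = Complex.I * (z + 1) / (z - 1) := by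
      simp only [map_div₀, map_mul, map_add, map_sub, map_one, Complex.conj_I]
      rw [div_eq_div_iff hzc hz1]
      linear_combination (-2 * Complex.I) * hzz
    obtain ⟨x, hx⟩ := Complex.conj_eq_iff_real.1 hreal
    refine ⟨x, Circle.ext ?_⟩
    rw [coe_cayley, div_eq_iff (sub_I_ne_zero x), ← hx]
    field_simp
    ring

theorem map_psi {μ : Measure Circle} (hμ1 : μ {1} = 0) : (psi μ).map cayley = μ := by
  rw [psi, measurableEmbedding_cayley.map_comap, range_cayley]
  exact Measure.restrict_eq_self_of_ae_mem (by rw [ae_iff]; simpa using hμ1)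

end RII

theorem corollary3p1 (c d : ℕ → ℝ) (hd : RII.IsPositiveChainSequence d)
    (μ : Measure Circle) [IsProbabilityMeasure μ]
    (hμ : RII.HasVerblunskyCoefficients μ (RII.alpha c d))
    (hμ1 : μ {1} = 0)
    (m k : ℕ) (hm : 1 ≤ m) (hk : 1 ≤ k) :
    Integrable (fun x : ℝ =>
      conj (RII.uHat c d m x) * RII.uHat c d k x * ((x : ℂ) ^ 2 + 1)) (RII.psi μ) ∧
    ∫ x : ℝ, conj (RII.uHat c d m x) * RII.uHat c d k x * ((x : ℂ) ^ 2 + 1) ∂(RII.psi μ) =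
      if m = k then 1 + (c 1 : ℂ) ^ 2 else 0 := by
  obtain ⟨Φ, h, hα⟩ := hμ
  obtain ⟨m, rfl⟩ := Nat.exists_eq_add_of_le' hm
  obtain ⟨k, rfl⟩ := Nat.exists_eq_add_of_le' hk
  set κ := conj (RII.kappa c d m) * RII.kappa c d k with hκ
  have hfun : (fun x : ℝ => conj (RII.uHat c d (m + 1) x) * RII.uHat c d (k + 1) x *
      ((x : ℂ) ^ 2 + 1)) = (fun z : Circle => κ * (conj ((Φ m).eval (z : ℂ)) *
        (Φ k).eval (z : ℂ))) ∘ RII.cayley := by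
    ext x
    have h1 := congrArg conj (RII.sub_I_mul_uHat c hd h hα m x)
    have h2 := RII.sub_I_mul_uHat c hd h hα k x
    rw [map_mul, map_mul, RII.conj_sub_I] at h1
    have h3 := congrArg₂ (· * ·) h1 h2
    rw [Function.comp_apply, hκ]
    -- One factor of x²+1 = (x+i)(x-i) goes to each of the two functions.
    linear_combination h3 + (conj (RII.uHat c d (m + 1) x) * RII.uHat c d (k + 1) x) *
      Complex.I_sq
  have hint := (RII.integrable_conj_eval_mul_eval μ (Φ m) (Φ k)).const_mul κ
  have hmap := RII.map_psi hμ1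
  rw [hfun]
  constructor
  · rw [← RII.measurableEmbedding_cayley.integrable_map_iff, hmap]
    exact hint
  · refine (RII.measurableEmbedding_cayley.integral_map (fun z : Circle =>
      κ * (conj ((Φ m).eval (z : ℂ)) * (Φ k).eval (z : ℂ)))).symm.trans ?_
    rw [hmap, integral_const_mul]
    split_ifs with hmk
    · obtain rfl : m = k := by omega
      exact RII.conj_kappa_mul_kappa_mul_circleInner c hd h hα m
    · rw [(h.2 m k).2 (by omega), mul_zero]
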